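/- Let $(\xi_n)_{n\ge 1}$ be independent identically distributed real random variables on a probability space, with $|\xi_n|\le 1$ and $\mathbb P\{\xi_1\in(1-\varepsilon,1]\}>0$ for every $\varepsilon>0$. Let $f:[0,\infty)\to[0,\infty)$ be continuous with $f(0)=0$, and let $K>0$ be a locally unstable (i.e. not Lyapunov stable) equilibrium, $f(K)=K$, such that $f(x)>x$ for $x\in(0,K)$ and $0<f(x)<x$ for $x>K$. Assume that for some $\theta\in(0,K)$, $\tilde L^-,\tilde L^+\in\mathbb R$ and $a_1,a_2>0$, $$f(x)-K\le \tilde L^-(K-x)\ \ (x\in[K-\theta,K]),\qquad K-f(x)\le \tilde L^+(x-K)\ \ (x\in[K,K+\theta]),$$ $$f(x)>a_1(K-x)+K\ \ (x\in(K-\theta,K)),\qquad f(x)<a_2(K-x)+K\ \ (x\in(K,K+\theta)).$$ Put $f_m=\max_{[0,K]}f$, $f_m^2=\inf_{(K,f_m)}f$, $G(\beta,x)=(1-\beta)f(x)+\beta x$, $G^2(\beta,x)=G(\beta,G(\beta,x))$, $\mathcal L^{\pm}(\beta)=(1-\beta)\tilde L^{\pm}-\beta$, and $$\underline\beta_*=\inf\{\beta\in(0,1):\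 G^2(\beta,x)>x\ \text{for } x\in(f_m^2,K)\ \text{and}\ G^2(\beta,x)<x\ \text{for } x\in(K,f_m)\}.$$ Let $\alpha,\ell$ be real numbers such that $$\mathbb E\ln\left|\mathcal L^-(\alpha+\ell\xi_1)\,\mathcal L^+(\alpha+\ell\xi_1)\right|<0,\qquad \alpha+\ell\le\min\left\{\frac{a_1}{a_1+1},\frac{a_2}{a_2+1}\right\},$$ $$0<\alpha<\underline\beta_*,\qquad \underline\beta_*-\alpha<\ell<\min\{\alpha,1-\alpha\}.$$ Then for every (deterministic) $x_0>0$ the solution of $$x_{n+1}=(1-\alpha-\ell\xi_{n+1})f(x_n)+(\alpha+\ell\xi_{n+1})x_n,\qquad n\ge 0,$$ satisfies $\lim_{n\to\infty}x_n=K$ almost surely. -/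

import Mathlib

open MeasureTheory ProbabilityTheory Filter Topology Set

noncomputable section

namespace PBC

/-- The sequence `ξ 0, ξ 1, …` lists the noises `ξ₁, ξ₂, …`: independent, identically distributed
random variables with values in `[-1, 1]` almost surely, whose law charges `(1 - ε, 1]` for every
`ε > 0`. -/
structure NoiseAssumption {Ω : Type*} [MeasurableSpace Ω] (μ : Measure Ω)
    (ξ : ℕ → Ω → ℝ) : Prop where
  measurable : ∀ n, Measurable (ξ n)
  indep : iIndepFun ξ μ
  identDistrib : ∀ n, IdentDistrib (ξ n) (ξ 0) μ μ
  bounded : ∀ n, ∀ᵐ ω ∂μ, |ξ n ω| ≤ 1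
  charges_one : ∀ ε : ℝ, 0 < ε → 0 < μ {ω | ξ 0 ω ∈ Ioc (1 - ε) 1}

/-- Lyapunov stability of `K` for the map `f` on `[0, ∞)`. -/
def IsLocallyStable (f : ℝ → ℝ) (K : ℝ) : Prop :=
  ∀ ε : ℝ, 0 < ε → ∃ δ : ℝ, 0 < δ ∧
    ∀ x : ℝ, 0 ≤ x → |x - K| < δ → ∀ n : ℕ, |f^[n] x - K| < ε

/-- The standing assumption on the map `f : [0, ∞) → [0, ∞)` and its positive equilibrium `K`.
Values of `f` at negative arguments play no role. -/
structure MapAssumption (f : ℝ → ℝ) (K : ℝ) : Prop where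
  K_pos : 0 < K
  mapsTo : MapsTo f (Ici 0) (Ici 0)
  continuousOn : ContinuousOn f (Ici 0)
  map_zero : f 0 = 0
  map_K : f K = K
  unstable : ¬ IsLocallyStable f K
  gt_self : ∀ x ∈ Ioo 0 K, x < f x
  pos_lt_self : ∀ x ∈ Ioi K, 0 < f x ∧ f x < x

/-- Local one-sided Lipschitz bounds at `K`. -/
def LocalLipschitz (f : ℝ → ℝ) (K θ Lm Lp : ℝ) : Prop :=
  (∀ x ∈ Icc (K - θ) K, f x - K ≤ Lm * (K - x)) ∧
    ∀ x ∈ Icc K (K + θ), K - f x ≤ Lp * (x - K)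

/-- `f` switches the side of `K`, with slopes at least `a₁` on the left and `a₂` on the right. -/
def SideSwitching (f : ℝ → ℝ) (K θ a₁ a₂ : ℝ) : Prop :=
  (∀ x ∈ Ioo (K - θ) K, a₁ * (K - x) + K < f x) ∧
    ∀ x ∈ Ioo K (K + θ), f x < a₂ * (K - x) + K

/-- `f_m`, the maximum of `f` on `[0, K]`. -/
def fMax (f : ℝ → ℝ) (K : ℝ) : ℝ := sSup (f '' Icc 0 K)

/-- `f_m²`, the infimum of `f` on `(K, f_m)`. -/
def fMin (f : ℝ → ℝ) (K : ℝ) : ℝ := sInf (f '' Ioo K (fMax f K))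

/-- The controlled map `G(β, x) = (1 - β) f(x) + β x`. -/
def G (f : ℝ → ℝ) (β x : ℝ) : ℝ := (1 - β) * f x + β * x

/-- The controls `β` for which the second iterate of `G(β, ·)` moves every point of
`(f_m², K)` to the right and every point of `(K, f_m)` to the left. -/
def stabilizing (f : ℝ → ℝ) (K : ℝ) : Set ℝ :=
  {β | β ∈ Ioo (0 : ℝ) 1 ∧
    (∀ x ∈ Ioo (fMin f K) K, x < G f β (G f β x)) ∧
    ∀ x ∈ Ioo K (fMax f K), G f β (G f β x) < x}

/-- The sharp deterministic control level. -/
def betaStar (f : ℝ → ℝ) (K : ℝ) : ℝ := sInf (stabilizing f K)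

/-- `𝓛(β) = (1 - β) L - β`. -/
def scrL (L β : ℝ) : ℝ := (1 - β) * L - β

/-- `x` solves `x_{n+1} = (1 - α - ℓ ξ_{n+1}) f(x_n) + (α + ℓ ξ_{n+1}) x_n` with initial value
`x₀`; recall that `ξ n` stands for `ξ_{n+1}`. -/
def IsSolution {Ω : Type*} (f : ℝ → ℝ) (α ℓ : ℝ) (ξ : ℕ → Ω → ℝ) (x₀ : ℝ)
    (x : ℕ → Ω → ℝ) : Prop :=
  (∀ ω, x 0 ω = x₀) ∧
    ∀ n ω, x (n + 1) ω = (1 - α - ℓ * ξ n ω) * f (x n ω) + (α + ℓ * ξ n ω) * x n ω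

end PBC

end

namespace PBC

/-! ### Deterministic dynamics of the controlled map -/

/-! The proof joins global attraction under a nearly constant strong control to local contraction
under typical noise. Globally, every positive trajectory enters `[f_m², f_m]` and stays there.
Stabilization is monotone in the control (`stabilizing_of_le`), so the constant control `α + ℓ`,
which exceeds `betaStar`, is stabilizing. Without two-cycles it shrinks the whole interval towards
`K` (`exists_iterate_near`), uniformly in the starting point, in a fixed number `N` of steps. By
continuity this persists when `N` consecutive noises are close to `1`. Locally, `α + ℓ ≤ aᵢ / (aᵢ +
1)` makes orbits alternate around `K`, so the distance to `K` is multiplied by rates with constants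
`Lm` and `Lp` in turn. The logarithmic hypothesis and the strong law, applied separately to even and
odd indices, send these products to `0` almost surely. They are therefore bounded by some `C` with
positive probability, and then an orbit starting within `θ / C` of `K` converges. The event "`N`
noises near `1`, then contracting noise" has positive probability. By stationarity and the zero-one
law it occurs at arbitrarily late times, hence after the random entry into the interval. -/

theorem continuousOn_G {f : ℝ → ℝ} {s : Set ℝ} (hf : ContinuousOn f s) (β : ℝ) :
    ContinuousOn (G f β) s := by
  unfold G
  fun_prop

theorem G_sub_self (f : ℝ → ℝ) (β x : ℝ) : G f β x - x = (1 - β) * (f x - x) := by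
  unfold G; ring

/-- Lowering the control pushes the image further in the direction of `f x - x`; the same identity
bounds the effect of perturbing the control. -/
theorem G_sub_G (f : ℝ → ℝ) (β γ x : ℝ) : G f γ x - G f β x = (β - γ) * (f x - x) := by
  unfold G; ring

namespace MapAssumption

variable {f : ℝ → ℝ} {K : ℝ}

theorem G_K (hf : MapAssumption f K) (β : ℝ) : G f β K = K := by
  unfold G; rw [hf.map_K]; ring

theorem lt_G (hf : MapAssumption f K) {β x : ℝ} (hβ : β < 1) (hx : x ∈ Ioo 0 K) : x < G f β x := by
  have h1 := G_sub_self f β x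
  have h2 : 0 < (1 - β) * (f x - x) :=
    mul_pos (by linarith) (by linarith [hf.gt_self x hx])
  linarith

theorem G_lt (hf : MapAssumption f K) {β x : ℝ} (hβ : β < 1) (hx : K < x) : G f β x < x := by
  have h1 := G_sub_self f β x
  have h2 : 0 < (1 - β) * (x - f x) :=
    mul_pos (by linarith) (by linarith [(hf.pos_lt_self x hx).2])
  linarith

theorem G_pos (hf : MapAssumption f K)
    {β x : ℝ} (hβ : β ∈ Ioo (0 : ℝ) 1) (hx : 0 < x) : 0 < G f β x := by
  have h1 : 0 ≤ f x := hf.mapsTo (mem_Ici.2 hx.le)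
  have h2 : 0 ≤ (1 - β) * f x := mul_nonneg (by linarith [hβ.2]) h1
  have h3 : 0 < β * x := mul_pos hβ.1 hx
  unfold G; linarith

theorem bddAbove_image (hf : MapAssumption f K) : BddAbove (f '' Icc 0 K) :=
  (isCompact_Icc.image_of_continuousOn
    (hf.continuousOn.mono Icc_subset_Ici_self)).bddAbove

theorem le_fMax (hf : MapAssumption f K) {x : ℝ} (hx : x ∈ Icc 0 K) : f x ≤ fMax f K :=
  le_csSup hf.bddAbove_image (mem_image_of_mem f hx)

theorem bddBelow_image (hf : MapAssumption f K) : BddBelow (f '' Ioo K (fMax f K)) := by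
  refine ⟨0, ?_⟩
  rintro _ ⟨x, hx, rfl⟩
  exact (hf.pos_lt_self x hx.1).1.le

theorem fMin_le_of_mem_Ioo (hf : MapAssumption f K)
    {x : ℝ} (hx : x ∈ Ioo K (fMax f K)) : fMin f K ≤ f x :=
  csInf_le hf.bddBelow_image (mem_image_of_mem f hx)

theorem K_lt_fMax (hf : MapAssumption f K) {θ a₁ a₂ : ℝ} (hθ : 0 < θ) (hθK : θ < K) (ha₁ : 0 < a₁)
    (hside : SideSwitching f K θ a₁ a₂) : K < fMax f K := by
  have h1 := hside.1 (K - θ / 2) ⟨by linarith, by linarith⟩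
  have h2 := hf.le_fMax (x := K - θ / 2) ⟨by linarith, by linarith⟩
  have h3 : 0 < a₁ * (K - (K - θ / 2)) := mul_pos ha₁ (by linarith)
  linarith

/-- The infimum is over an open interval; continuity carries the bound to the endpoints. -/
theorem fMin_le (hf : MapAssumption f K)
    {x : ℝ} (hK : K < fMax f K) (hx : x ∈ Icc K (fMax f K)) : fMin f K ≤ f x := by
  rw [← closure_Ioo hK.ne] at hx
  have hc : ContinuousOn f (closure (Ioo K (fMax f K))) := by
    rw [closure_Ioo hK.ne]
    exact hf.continuousOn.mono fun y hy => hf.K_pos.le.trans hy.1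
  have h := hc.image_closure (mem_image_of_mem f hx)
  have hsub : f '' Ioo K (fMax f K) ⊆ Ici (fMin f K) := by
    rintro _ ⟨y, hy, rfl⟩
    exact hf.fMin_le_of_mem_Ioo hy
  exact closure_minimal hsub isClosed_Ici h

theorem fMin_pos (hf : MapAssumption f K) (hK : K < fMax f K) : 0 < fMin f K := by
  have hc : ContinuousOn f (Icc K (fMax f K)) :=
    hf.continuousOn.mono fun y hy => hf.K_pos.le.trans hy.1
  obtain ⟨z, hz, hmin⟩ := isCompact_Icc.exists_isMinOn (nonempty_Icc.2 hK.le) hc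
  have hzpos : 0 < f z := by
    rcases hz.1.eq_or_lt with h | h
    · rw [← h, hf.map_K]; exact hf.K_pos
    · exact (hf.pos_lt_self z h).1
  refine hzpos.trans_le (le_csInf ((nonempty_Ioo.2 hK).image f) ?_)
  rintro _ ⟨y, hy, rfl⟩
  exact hmin (Ioo_subset_Icc_self hy)

theorem fMin_lt_K (hf : MapAssumption f K) {θ a₁ a₂ : ℝ} (hθ : 0 < θ) (ha₂ : 0 < a₂)
    (hside : SideSwitching f K θ a₁ a₂) (hK : K < fMax f K) : fMin f K < K := by
  obtain ⟨z, hz1, hz2⟩ := exists_between (lt_min hK (show K < K + θ by linarith))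
  have h1 := hside.2 z ⟨hz1, hz2.trans_le (min_le_right _ _)⟩
  have h2 := hf.fMin_le_of_mem_Ioo (x := z) ⟨hz1, hz2.trans_le (min_le_left _ _)⟩
  have h3 : 0 < a₂ * (z - K) := mul_pos ha₂ (by linarith)
  linarith

theorem fMin_nonneg (hf : MapAssumption f K) : 0 ≤ fMin f K := by
  refine Real.sInf_nonneg ?_
  rintro _ ⟨x, hx, rfl⟩
  exact (hf.pos_lt_self x hx.1).1.le

/-- Every control above a stabilizing one is stabilizing. -/
theorem stabilizing_of_le (hf : MapAssumption f K)
    {β₀ β : ℝ} (h₀ : β₀ ∈ stabilizing f K) (hle : β₀ ≤ β) (hβ : β < 1) :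
    β ∈ stabilizing f K := by
  obtain ⟨⟨h0pos, h01⟩, hleft, hright⟩ := h₀
  have hK := hf.K_pos
  have hm := hf.fMin_nonneg
  have hβ01 : β ∈ Ioo (0 : ℝ) 1 := ⟨by linarith, hβ⟩
  refine ⟨hβ01, ?_, ?_⟩
  · intro x hx
    -- A return to or below `x` forces `y = G f β x` beyond `K`. The smaller control `β₀` moves both
    -- `x` and `y` at least as far, so the intermediate value theorem yields `z ∈ [x, K)` with `G f
    -- β₀ z = y`. Then `G f β₀ y ≤ x ≤ z` contradicts the choice of `β₀`. The other half is
    -- symmetric.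
    by_contra! hcon
    have hx0 : 0 < x := hm.trans_lt hx.1
    have hxy : x < G f β x := hf.lt_G hβ ⟨hx0, hx.2⟩
    set y := G f β x with hy
    have hyK : K < y := by
      by_contra! hyK
      rcases hyK.eq_or_lt with h | h
      · rw [h, hf.G_K] at hcon; linarith [hx.2]
      · linarith [hf.lt_G hβ ⟨hx0.trans hxy, h⟩]
    have e1 : y ≤ G f β₀ x := by
      have h1 := G_sub_G f β β₀ x
      have h2 : 0 ≤ (β - β₀) * (f x - x) :=
        mul_nonneg (by linarith) (by linarith [hf.gt_self x ⟨hx0, hx.2⟩])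
      linarith
    have e2 : G f β₀ y ≤ x := by
      have h1 := G_sub_G f β β₀ y
      have h2 : 0 ≤ (β - β₀) * (y - f y) :=
        mul_nonneg (by linarith) (by linarith [(hf.pos_lt_self y hyK).2])
      linarith
    have hc : ContinuousOn (G f β₀) (Icc x K) :=
      continuousOn_G (hf.continuousOn.mono fun z hz => hx0.le.trans hz.1) β₀
    obtain ⟨z, hz, hzy⟩ := intermediate_value_Icc' hx.2.le hc
      (show y ∈ Icc (G f β₀ K) (G f β₀ x) from ⟨by rw [hf.G_K]; exact hyK.le, e1⟩)
    have hzK : z < K := by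
      refine lt_of_le_of_ne hz.2 ?_
      rintro rfl
      rw [hf.G_K] at hzy; linarith
    have := hleft z ⟨hx.1.trans_le hz.1, hzK⟩
    rw [hzy] at this
    linarith [hz.1]
  · intro x hx
    by_contra! hcon
    have hx0 : 0 < x := hK.trans hx.1
    have hxy : G f β x < x := hf.G_lt hβ hx.1
    have hy0 : 0 < G f β x := hf.G_pos hβ01 hx0
    set y := G f β x with hy
    have hyK : y < K := by
      by_contra! hyK
      rcases hyK.eq_or_lt with h | h
      · rw [← h, hf.G_K] at hcon; linarith [hx.1]
      · linarith [hf.G_lt hβ h]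
    have e1 : G f β₀ x ≤ y := by
      have h1 := G_sub_G f β β₀ x
      have h2 : 0 ≤ (β - β₀) * (x - f x) :=
        mul_nonneg (by linarith) (by linarith [(hf.pos_lt_self x hx.1).2])
      linarith
    have e2 : x ≤ G f β₀ y := by
      have h1 := G_sub_G f β β₀ y
      have h2 : 0 ≤ (β - β₀) * (f y - y) :=
        mul_nonneg (by linarith) (by linarith [hf.gt_self y ⟨hy0, hyK⟩])
      linarith
    have hc : ContinuousOn (G f β₀) (Icc K x) :=
      continuousOn_G (hf.continuousOn.mono fun z hz => hK.le.trans hz.1) β₀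
    obtain ⟨z, hz, hzy⟩ := intermediate_value_Icc' hx.1.le hc
      (show y ∈ Icc (G f β₀ x) (G f β₀ K) from ⟨e1, by rw [hf.G_K]; exact hyK.le⟩)
    have hzK : K < z := by
      refine lt_of_le_of_ne hz.1 ?_
      rintro rfl
      rw [hf.G_K] at hzy; linarith
    have := hright z ⟨hzK, hz.2.trans_lt hx.2⟩
    rw [hzy] at this
    linarith [hz.2]

/-- Left of `K` the value averages `f x ≤ f_m` with `x < f_m`, the latter with positive weight;
right of `K` the map decreases `x`. -/
theorem G_lt_fMax (hf : MapAssumption f K) {β x : ℝ} (hβ : β ∈ Ioo (0 : ℝ) 1) (hK : K < fMax f K)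
    (hx : x ∈ Icc 0 (fMax f K)) : G f β x < fMax f K := by
  rcases le_or_gt x K with h | h
  · have h1 : (1 - β) * f x ≤ (1 - β) * fMax f K :=
      mul_le_mul_of_nonneg_left (hf.le_fMax ⟨hx.1, h⟩) (by linarith [hβ.2])
    have h2 : β * x < β * fMax f K := mul_lt_mul_of_pos_left (h.trans_lt hK) hβ.1
    unfold G; linarith
  · exact (hf.G_lt hβ.2 h).trans_le hx.2

theorem fMin_lt_G (hf : MapAssumption f K)
    {β x : ℝ} (hβ : β ∈ Ioo (0 : ℝ) 1) (hK : K < fMax f K) (hmK : fMin f K < K)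
    (hx : x ∈ Icc (fMin f K) (fMax f K)) : fMin f K < G f β x := by
  rcases lt_or_ge x K with h | h
  · exact hx.1.trans_lt (hf.lt_G hβ.2 ⟨(hf.fMin_pos hK).trans_le hx.1, h⟩)
  · have h1 : (1 - β) * fMin f K ≤ (1 - β) * f x :=
      mul_le_mul_of_nonneg_left (hf.fMin_le hK ⟨h, hx.2⟩) (by linarith [hβ.2])
    have h2 : β * fMin f K < β * x := mul_lt_mul_of_pos_left (hmK.trans_le h) hβ.1
    unfold G; linarith

theorem G_mem_Ioo (hf : MapAssumption f K)
    {β x : ℝ} (hβ : β ∈ Ioo (0 : ℝ) 1) (hK : K < fMax f K) (hmK : fMin f K < K)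
    (hx : x ∈ Icc (fMin f K) (fMax f K)) : G f β x ∈ Ioo (fMin f K) (fMax f K) :=
  ⟨hf.fMin_lt_G hβ hK hmK hx, hf.G_lt_fMax hβ hK ⟨hf.fMin_nonneg.trans hx.1, hx.2⟩⟩

/-- A trajectory cannot converge to a positive point other than `K`. -/
theorem eq_K_of_tendsto (hf : MapAssumption f K)
    {b y : ℕ → ℝ} {c l : ℝ} (hc : 0 < c) (hb : ∀ n, c ≤ 1 - b n)
    (hy : ∀ n, y (n + 1) = G f (b n) (y n)) (hl : 0 < l) (hlim : Tendsto y atTop (𝓝 l)) :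
    l = K := by
  have hfl : Tendsto (fun n => f (y n)) atTop (𝓝 (f l)) :=
    (hf.continuousOn.continuousAt (Ici_mem_nhds hl)).tendsto.comp hlim
  have h1 : Tendsto (fun n => |y (n + 1) - y n|) atTop (𝓝 0) := by
    simpa using ((hlim.comp (tendsto_add_atTop_nat 1)).sub hlim).abs
  have h2 : Tendsto (fun n => c * |f (y n) - y n|) atTop (𝓝 (c * |f l - l|)) :=
    ((hfl.sub hlim).abs).const_mul c
  -- The controls need not converge, so the limit is taken in `c * |f (y n) - y n| ≤ |y (n + 1) - y
  -- n|`.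
  have h3 : c * |f l - l| ≤ 0 := by
    refine le_of_tendsto_of_tendsto' h2 h1 fun n => ?_
    rw [hy n, G_sub_self, abs_mul]
    exact mul_le_mul_of_nonneg_right ((hb n).trans (le_abs_self _)) (abs_nonneg _)
  have h4 : f l = l := by
    have h5 : |f l - l| ≤ 0 := by
      by_contra! h
      linarith [mul_pos hc h]
    linarith [abs_nonpos_iff.1 h5]
  rcases lt_trichotomy l K with h | h | h
  · linarith [hf.gt_self l ⟨hl, h⟩]
  · exact h
  · linarith [(hf.pos_lt_self l h).2]

/-- Every trajectory with positive initial value enters `[f_m², f_m]` and stays there. -/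
theorem eventually_mem_Icc (hf : MapAssumption f K)
    {b y : ℕ → ℝ} {c : ℝ} (hc : 0 < c) (hb : ∀ n, c ≤ 1 - b n)
    (hb0 : ∀ n, 0 < b n) (hy : ∀ n, y (n + 1) = G f (b n) (y n)) (hy0 : 0 < y 0)
    (hK : K < fMax f K) (hmK : fMin f K < K) :
    ∃ n₀, ∀ n, n₀ ≤ n → y n ∈ Icc (fMin f K) (fMax f K) := by
  have hb1 : ∀ n, b n ∈ Ioo (0 : ℝ) 1 := fun n => ⟨hb0 n, by linarith [hb n]⟩
  have hpos : ∀ n, 0 < y n := by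
    intro n
    induction n with
    | zero => exact hy0
    | succ n ih => rw [hy n]; exact hf.G_pos (hb1 n) ih
  have hdown : ∃ n, y n ≤ fMax f K := by
    -- Above `f_m > K` the orbit decreases, and its limit would be an impossible equilibrium.
    by_contra! hcon
    have hanti : Antitone y := antitone_nat_of_succ_le fun n => by
      rw [hy n]; exact (hf.G_lt (hb1 n).2 (hK.trans (hcon n))).le
    have hlim := tendsto_atTop_ciInf hanti ⟨fMax f K, by rintro _ ⟨n, rfl⟩; exact (hcon n).le⟩
    have hge : fMax f K ≤ ⨅ n, y n := ge_of_tendsto' hlim fun n => (hcon n).le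
    have := hf.eq_K_of_tendsto hc hb hy (hf.K_pos.trans (hK.trans_le hge)) hlim
    linarith
  obtain ⟨n₁, hn₁⟩ := hdown
  have hle : ∀ n, n₁ ≤ n → y n ≤ fMax f K := by
    intro n hn
    induction n, hn using Nat.le_induction with
    | base => exact hn₁
    | succ n _ ih => rw [hy n]; exact (hf.G_lt_fMax (hb1 n) hK ⟨(hpos n).le, ih⟩).le
  have hup : ∃ n, n₁ ≤ n ∧ fMin f K ≤ y n := by
    by_contra! hcon
    have hmono : Monotone fun n => y (n + n₁) := monotone_nat_of_le_succ fun n => by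
      have h := hcon (n + n₁) (Nat.le_add_left _ _)
      rw [show n + 1 + n₁ = n + n₁ + 1 by ring, hy (n + n₁)]
      exact (hf.lt_G (hb1 _).2 ⟨hpos _, h.trans hmK⟩).le
    have hlim := tendsto_atTop_ciSup hmono
      ⟨fMin f K, by rintro _ ⟨n, rfl⟩; exact (hcon _ (Nat.le_add_left _ _)).le⟩
    have hge : (⨆ n, y (n + n₁)) ≤ fMin f K :=
      le_of_tendsto' hlim fun n => (hcon _ (Nat.le_add_left _ _)).le
    have hle0 : y (0 + n₁) ≤ ⨆ n, y (n + n₁) := hmono.ge_of_tendsto hlim 0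
    have := hf.eq_K_of_tendsto (b := fun n => b (n + n₁)) hc (fun n => hb _)
      (fun n => by rw [show n + 1 + n₁ = n + n₁ + 1 by ring]; exact hy _)
      ((hpos _).trans_le hle0) hlim
    linarith
  obtain ⟨n₂, hn₂, hn₂'⟩ := hup
  refine ⟨n₂, fun n hn => ?_⟩
  induction n, hn using Nat.le_induction with
  | base => exact ⟨hn₂', hle n₂ hn₂⟩
  | succ n _ ih => rw [hy n]; exact Ioo_subset_Icc_self (hf.G_mem_Ioo (hb1 n) hK hmK ih)

end MapAssumption

/-! ### Uniform attraction to `K` under a stabilizing control -/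

/-- Limits of values over shrinking intervals are values over the limit interval. -/
theorem mem_image_Icc_of_tendsto {g : ℝ → ℝ} {p q : ℝ} (hg : ContinuousOn g (Icc p q))
    {a b c : ℕ → ℝ} {a' b' c' : ℝ} (ha : Tendsto a atTop (𝓝 a')) (hb : Tendsto b atTop (𝓝 b'))
    (hc : Tendsto c atTop (𝓝 c')) (hsub : ∀ n, Icc (a n) (b n) ⊆ Icc p q)
    (hmem : ∀ n, c n ∈ g '' Icc (a n) (b n)) : c' ∈ g '' Icc a' b' := by
  choose v hv hgv using hmem
  obtain ⟨l, hl, φ, hφ, hlim⟩ := isCompact_Icc.tendsto_subseq fun n => hsub n (hv n)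
  have hφt := hφ.tendsto_atTop
  refine ⟨l, ⟨le_of_tendsto_of_tendsto' (ha.comp hφt) hlim fun n => (hv _).1,
    le_of_tendsto_of_tendsto' hlim (hb.comp hφt) fun n => (hv _).2⟩, ?_⟩
  have h1 : Tendsto (fun n => g (v (φ n))) atTop (𝓝 (g l)) :=
    (hg l hl).tendsto.comp (tendsto_nhdsWithin_iff.2
      ⟨hlim, Eventually.of_forall fun n => hsub _ (hv _)⟩)
  refine tendsto_nhds_unique h1 ?_
  simp only [hgv]
  exact hc.comp hφt

/-- A continuous interval map with a single fixed point and no two-cycle shrinks the interval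
to the fixed point under iteration. -/
theorem exists_iterate_near {g : ℝ → ℝ} {p q K : ℝ} (hg : ContinuousOn g (Icc p q))
    (hK : K ∈ Ioo p q) (hmaps : ∀ x ∈ Icc p q, g x ∈ Ioo p q) (hgK : g K = K)
    (hleft : ∀ x ∈ Ioo p K, x < g x) (hright : ∀ x ∈ Ioc K q, g x < x)
    (htwo : ∀ x ∈ Ioo p K, x < g (g x)) {δ : ℝ} (hδ : 0 < δ) :
    ∃ N, ∀ x ∈ Icc p q, |g^[N] x - K| < δ := by
  have hmaps' : MapsTo g (Icc p q) (Icc p q) := fun x hx => Ioo_subset_Icc_self (hmaps x hx)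
  have hpq : p ≤ q := (hK.1.trans hK.2).le
  have hKI : K ∈ Icc p q := Ioo_subset_Icc_self hK
  have hcont : ∀ n, ContinuousOn g^[n] (Icc p q) := fun n => hg.iterate hmaps' n
  -- The iterated images are nested compact intervals `[a n, b n]`. In the limit `[A, B]`, both
  -- endpoints are again values of `g` on `[A, B]`.
  set a : ℕ → ℝ := fun n => sInf (g^[n] '' Icc p q) with ha
  set b : ℕ → ℝ := fun n => sSup (g^[n] '' Icc p q) with hb
  have himg : ∀ n, g^[n] '' Icc p q = Icc (a n) (b n) := fun n => (hcont n).image_Icc hpq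
  have hKab : ∀ n, K ∈ Icc (a n) (b n) := fun n => by
    rw [← himg n]
    exact ⟨K, hKI, Function.iterate_fixed hgK n⟩
  have hab : ∀ n, a n ≤ b n := fun n => (hKab n).1.trans (hKab n).2
  have hsub : ∀ n, Icc (a n) (b n) ⊆ Icc p q := fun n => by
    rw [← himg n]
    exact (hmaps'.iterate n).image_subset
  have hstep : ∀ n, Icc (a (n + 1)) (b (n + 1)) = g '' Icc (a n) (b n) := fun n => by
    rw [← himg n, ← himg (n + 1), Function.iterate_succ', image_comp]
  have hdec : ∀ n, Icc (a (n + 1)) (b (n + 1)) ⊆ Icc (a n) (b n) := fun n => by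
    rw [← himg n, ← himg (n + 1), Function.iterate_succ, image_comp]
    exact image_mono hmaps'.image_subset
  have hmono : Monotone a := monotone_nat_of_le_succ fun n =>
    ((Icc_subset_Icc_iff (hab _)).1 (hdec n)).1
  have hanti : Antitone b := antitone_nat_of_succ_le fun n =>
    ((Icc_subset_Icc_iff (hab _)).1 (hdec n)).2
  obtain ⟨A, hA⟩ : ∃ A, Tendsto a atTop (𝓝 A) :=
    ⟨_, tendsto_atTop_ciSup hmono ⟨K, by rintro _ ⟨n, rfl⟩; exact (hKab n).1⟩⟩
  obtain ⟨B, hB⟩ : ∃ B, Tendsto b atTop (𝓝 B) :=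
    ⟨_, tendsto_atTop_ciInf hanti ⟨K, by rintro _ ⟨n, rfl⟩; exact (hKab n).2⟩⟩
  have hAK : A ≤ K := le_of_tendsto' hA fun n => (hKab n).1
  have hKB : K ≤ B := ge_of_tendsto' hB fun n => (hKab n).2
  have hABsub : Icc A B ⊆ Icc p q := Icc_subset_Icc
    (ge_of_tendsto' hA fun n => (hsub n (left_mem_Icc.2 (hab n))).1)
    (le_of_tendsto' hB fun n => (hsub n (right_mem_Icc.2 (hab n))).2)
  obtain ⟨v, hv, hgv⟩ : A ∈ g '' Icc A B :=
    mem_image_Icc_of_tendsto hg hA hB (hA.comp (tendsto_add_atTop_nat 1)) hsub fun n => by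
      rw [← hstep n]; exact left_mem_Icc.2 (hab _)
  obtain ⟨u, hu, hgu⟩ : B ∈ g '' Icc A B :=
    mem_image_Icc_of_tendsto hg hA hB (hB.comp (tendsto_add_atTop_nat 1)) hsub fun n => by
      rw [← hstep n]; exact right_mem_Icc.2 (hab _)
  -- Strictness comes from mapping into the open interval; it places the points used below where
  -- `hleft` and `htwo` apply.
  have hpA : p < A := hgv ▸ (hmaps v (hABsub hv)).1
  have huK : u ≤ K := by
    by_contra! h
    linarith [hright u ⟨h, (hABsub hu).2⟩, hu.2]
  have hAeq : A = K := by
    by_contra hne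
    have hlt : A < K := lt_of_le_of_ne hAK hne
    have hvK : K < v := by
      by_contra! h
      rcases h.eq_or_lt with h | h
      · rw [h, hgK] at hgv; exact hne hgv.symm
      · linarith [hleft v ⟨hpA.trans_le hv.1, h⟩, hv.1]
    -- Since `g K < v ≤ B = g u`, some `z ∈ [u, K)` has `g z = v`, whence `g (g z) = A ≤ z`, against
    -- `htwo`.
    obtain ⟨z, hz, hgz⟩ := intermediate_value_Icc' huK
      (hg.mono (Icc_subset_Icc (hABsub hu).1 hKI.2))
      (show v ∈ Icc (g K) (g u) from ⟨by rw [hgK]; exact hvK.le, by rw [hgu]; exact hv.2⟩)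
    have hzK : z < K := by
      refine lt_of_le_of_ne hz.2 ?_
      rintro rfl
      rw [hgK] at hgz; linarith
    have := htwo z ⟨hpA.trans_le (hu.1.trans hz.1), hzK⟩
    rw [hgz, hgv] at this
    linarith [hu.1, hz.1]
  have hBeq : B = K := by
    have : u = K := le_antisymm huK (hAeq ▸ hu.1)
    rw [← hgu, this, hgK]
  rw [hAeq] at hA
  rw [hBeq] at hB
  obtain ⟨N, hN1, hN2⟩ := ((hA.eventually (lt_mem_nhds (show K - δ < K by linarith))).and
    (hB.eventually (gt_mem_nhds (show K < K + δ by linarith)))).exists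
  refine ⟨N, fun x hx => ?_⟩
  have hmem : g^[N] x ∈ Icc (a N) (b N) := by rw [← himg N]; exact mem_image_of_mem _ hx
  rw [abs_lt]
  constructor <;> linarith [hmem.1, hmem.2]

/-- Finite trajectories depend continuously on the controls, uniformly in the initial value. -/
theorem exists_trajectory_near_iterate {f : ℝ → ℝ} {p q β : ℝ} (hf : ContinuousOn f (Icc p q))
    (hmaps : MapsTo (G f β) (Icc p q) (Icc p q)) (N : ℕ) {η : ℝ} (hη : 0 < η) :
    ∃ ε, 0 < ε ∧ ∀ b y : ℕ → ℝ, (∀ n, y (n + 1) = G f (b n) (y n)) → (∀ n, y n ∈ Icc p q) →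
      (∀ n < N, |b n - β| ≤ ε) → |y N - (G f β)^[N] (y 0)| < η := by
  induction N generalizing η with
  | zero => exact ⟨1, one_pos, fun b y _ _ _ => by simpa using hη⟩
  | succ N ih =>
    have hG := continuousOn_G hf β
    obtain ⟨M, hM⟩ := isCompact_Icc.exists_bound_of_continuousOn (hf.sub continuousOn_id)
    obtain ⟨η', hη', hunif⟩ := Metric.uniformContinuousOn_iff.1
      (isCompact_Icc.uniformContinuousOn_of_continuous hG) (η / 2) (by linarith)
    obtain ⟨ε, hε, hnear⟩ := ih hη'
    -- Half of `η` pays for changing the last control, as `|f x - x| ≤ |M| + 1`; the other half is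
    -- uniform continuity of `G f β`.
    refine ⟨min ε (η / (2 * (|M| + 1))), by positivity, fun b y hy hmem hb => ?_⟩
    have h1 := hnear b y hy hmem fun n hn =>
      (hb n (hn.trans (Nat.lt_succ_self N))).trans (min_le_left _ _)
    have h2 := hunif (y N) (hmem N) _ (hmaps.iterate N (hmem 0)) (by rwa [Real.dist_eq])
    rw [Real.dist_eq] at h2
    have h3 : |G f (b N) (y N) - G f β (y N)| ≤ η / 2 := by
      rw [G_sub_G, abs_mul, abs_sub_comm]
      have h4 : |f (y N) - y N| ≤ |M| + 1 := by
        have := hM (y N) (hmem N)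
        rw [Real.norm_eq_abs] at this
        exact this.trans (by linarith [le_abs_self M])
      calc |b N - β| * |f (y N) - y N| ≤ η / (2 * (|M| + 1)) * (|M| + 1) :=
            mul_le_mul ((hb N (Nat.lt_succ_self N)).trans (min_le_right _ _)) h4
              (abs_nonneg _) (by positivity)
        _ = η / 2 := by field_simp
    rw [hy N, Function.iterate_succ_apply']
    calc _ ≤ |G f (b N) (y N) - G f β (y N)| + |G f β (y N) - G f β ((G f β)^[N] (y 0))| :=
          abs_sub_le _ _ _
      _ < η := by linarith

/-! ### Local contraction with alternating sides -/

/-- The product of the rates `𝓛(b j)`, `j < n`, with constants `L₀, L₁, L₀, …` in turn. -/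
noncomputable def altProd (L₀ L₁ : ℝ) (b : ℕ → ℝ) (n : ℕ) : ℝ :=
  ∏ j ∈ Finset.range n, scrL (if Even j then L₀ else L₁) (b j)

/-- The bound `C` keeps the orbit within `θ` of `K`, so the local estimates apply at each step.
Abstract sides `S₀`, `S₁` serve starts on either side of `K`. -/
theorem abs_sub_le_altProd {f : ℝ → ℝ} {K θ L₀ L₁ C : ℝ} {S₀ S₁ : Set ℝ} {b y : ℕ → ℝ}
    (h₀ : ∀ n, ∀ x ∈ S₀, |x - K| < θ →
      G f (b n) x ∈ S₁ ∧ |G f (b n) x - K| ≤ scrL L₀ (b n) * |x - K|)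
    (h₁ : ∀ n, ∀ x ∈ S₁, |x - K| < θ →
      G f (b n) x ∈ S₀ ∧ |G f (b n) x - K| ≤ scrL L₁ (b n) * |x - K|)
    (hL₀ : ∀ n, 0 ≤ scrL L₀ (b n)) (hL₁ : ∀ n, 0 ≤ scrL L₁ (b n))
    (hy : ∀ n, y (n + 1) = G f (b n) (y n)) (hy0 : y 0 ∈ S₀)
    (hC : ∀ n, altProd L₀ L₁ b n ≤ C) (hθ : C * |y 0 - K| < θ) (n : ℕ) :
    y n ∈ (if Even n then S₀ else S₁) ∧ |y n - K| ≤ altProd L₀ L₁ b n * |y 0 - K| := by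
  induction n with
  | zero => simpa [altProd] using hy0
  | succ n ih =>
    obtain ⟨hside, hbound⟩ := ih
    have hn : |y n - K| < θ :=
      (hbound.trans (mul_le_mul_of_nonneg_right (hC n) (abs_nonneg _))).trans_lt hθ
    have hprod : altProd L₀ L₁ b (n + 1) =
        altProd L₀ L₁ b n * scrL (if Even n then L₀ else L₁) (b n) := Finset.prod_range_succ _ _
    rw [hprod, hy n]
    by_cases hev : Even n
    · have hev' : ¬ Even (n + 1) := by simpa [Nat.even_add_one] using hev
      rw [if_pos hev] at hside ⊢
      rw [if_neg hev']
      obtain ⟨h1, h2⟩ := h₀ n _ hside hn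
      refine ⟨h1, h2.trans ?_⟩
      calc _ ≤ scrL L₀ (b n) * (altProd L₀ L₁ b n * |y 0 - K|) :=
            mul_le_mul_of_nonneg_left hbound (hL₀ n)
        _ = _ := by ring
    · have hev' : Even (n + 1) := by simpa [Nat.even_add_one] using hev
      rw [if_neg hev] at hside ⊢
      rw [if_pos hev']
      obtain ⟨h1, h2⟩ := h₁ n _ hside hn
      refine ⟨h1, h2.trans ?_⟩
      calc _ ≤ scrL L₁ (b n) * (altProd L₀ L₁ b n * |y 0 - K|) :=
            mul_le_mul_of_nonneg_left hbound (hL₁ n)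
        _ = _ := by ring

theorem le_one_sub_mul_of_le_div {a β : ℝ} (ha : 0 < a) (hβ : β ≤ a / (a + 1)) :
    β ≤ (1 - β) * a := by
  rw [le_div_iff₀ (by linarith)] at hβ
  linarith

/-- The slope bound leaves `G f β x - K > ((1 - β) * a₁ - β) * (K - x) ≥ 0`, so the side still
switches and the one-sided Lipschitz bound controls the absolute value. -/
theorem G_left {f : ℝ → ℝ} {K θ Lm Lp a₁ a₂ β x : ℝ} (hloc : LocalLipschitz f K θ Lm Lp)
    (hside : SideSwitching f K θ a₁ a₂) (hβ : β < 1) (ha : β ≤ (1 - β) * a₁)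
    (hx : x < K) (hxθ : |x - K| < θ) :
    K < G f β x ∧ |G f β x - K| ≤ scrL Lm β * |x - K| := by
  have hxabs : |x - K| = K - x := by rw [abs_of_neg (by linarith)]; ring
  rw [hxabs] at hxθ ⊢
  have h1 := mul_lt_mul_of_pos_left (hside.1 x ⟨by linarith, hx⟩) (show 0 < 1 - β by linarith)
  have h2 := mul_le_mul_of_nonneg_left (hloc.1 x ⟨by linarith, hx.le⟩)
    (show 0 ≤ 1 - β by linarith)
  have h3 := mul_le_mul_of_nonneg_right ha (show 0 ≤ K - x by linarith)
  have hG : K < G f β x := by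
    unfold G; linarith
  refine ⟨hG, ?_⟩
  rw [abs_of_pos (by linarith)]
  unfold G scrL
  linarith

theorem G_right {f : ℝ → ℝ} {K θ Lm Lp a₁ a₂ β x : ℝ} (hloc : LocalLipschitz f K θ Lm Lp)
    (hside : SideSwitching f K θ a₁ a₂) (hβ : β < 1) (ha : β ≤ (1 - β) * a₂)
    (hx : K < x) (hxθ : |x - K| < θ) :
    G f β x < K ∧ |G f β x - K| ≤ scrL Lp β * |x - K| := by
  have hxabs : |x - K| = x - K := abs_of_pos (by linarith)
  rw [hxabs] at hxθ ⊢
  have h1 := mul_lt_mul_of_pos_left (hside.2 x ⟨hx, by linarith⟩) (show 0 < 1 - β by linarith)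
  have h2 := mul_le_mul_of_nonneg_left (hloc.2 x ⟨hx.le, by linarith⟩)
    (show 0 ≤ 1 - β by linarith)
  have h3 := mul_le_mul_of_nonneg_right ha (show 0 ≤ x - K by linarith)
  have hG : G f β x < K := by
    unfold G; linarith
  refine ⟨hG, ?_⟩
  rw [abs_of_neg (by linarith)]
  unfold G scrL
  linarith

theorem lt_left_const {f : ℝ → ℝ} {K θ Lm Lp a₁ a₂ : ℝ} (hθ : 0 < θ)
    (hloc : LocalLipschitz f K θ Lm Lp) (hside : SideSwitching f K θ a₁ a₂) : a₁ < Lm := by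
  have h1 := hside.1 (K - θ / 2) ⟨by linarith, by linarith⟩
  have h2 := hloc.1 (K - θ / 2) ⟨by linarith, by linarith⟩
  have h3 : a₁ * (K - (K - θ / 2)) < Lm * (K - (K - θ / 2)) := by linarith
  exact lt_of_mul_lt_mul_right h3 (by linarith)

theorem lt_right_const {f : ℝ → ℝ} {K θ Lm Lp a₁ a₂ : ℝ} (hθ : 0 < θ)
    (hloc : LocalLipschitz f K θ Lm Lp) (hside : SideSwitching f K θ a₁ a₂) : a₂ < Lp := by
  have h1 := hside.2 (K + θ / 2) ⟨by linarith, by linarith⟩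
  have h2 := hloc.2 (K + θ / 2) ⟨by linarith, by linarith⟩
  have h3 : a₂ * (K + θ / 2 - K) < Lp * (K + θ / 2 - K) := by linarith
  exact lt_of_mul_lt_mul_right h3 (by linarith)

/-- The rate `𝓛(β)` stays between two positive constants. -/
theorem scrL_mem_Icc {a L β c : ℝ} (ha : 0 < a) (haL : a < L) (hβ0 : 0 ≤ β) (hc : c ≤ 1 - β)
    (hβ : β ≤ (1 - β) * a) : scrL L β ∈ Icc (c * (L - a)) L := by
  have h1 := mul_le_mul_of_nonneg_right hc (show 0 ≤ L - a by linarith)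
  have h2 : 0 ≤ β * L := mul_nonneg hβ0 (by linarith)
  -- The lower bound rests on `scrL L β = (1 - β) * (L - a) + ((1 - β) * a - β)`, whose last bracket
  -- is nonnegative.
  unfold scrL
  constructor <;> linarith

/-- A trajectory that starts close to `K`, with bounded and vanishing products of rates,
converges to `K`. -/
theorem tendsto_of_altProd {f : ℝ → ℝ} {K θ Lm Lp a₁ a₂ C : ℝ} {b y : ℕ → ℝ} (hfK : f K = K)
    (hθ : 0 < θ) (ha₁ : 0 < a₁) (ha₂ : 0 < a₂)
    (hloc : LocalLipschitz f K θ Lm Lp) (hside : SideSwitching f K θ a₁ a₂)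
    (hb0 : ∀ n, 0 ≤ b n) (hb1 : ∀ n, b n < 1)
    (hba₁ : ∀ n, b n ≤ (1 - b n) * a₁) (hba₂ : ∀ n, b n ≤ (1 - b n) * a₂)
    (hy : ∀ n, y (n + 1) = G f (b n) (y n))
    (hCm : ∀ n, altProd Lm Lp b n ≤ C) (hCp : ∀ n, altProd Lp Lm b n ≤ C)
    (hlm : Tendsto (altProd Lm Lp b) atTop (𝓝 0)) (hlp : Tendsto (altProd Lp Lm b) atTop (𝓝 0))
    (hy0 : C * |y 0 - K| < θ) : Tendsto y atTop (𝓝 K) := by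
  have hLm : ∀ n, 0 ≤ scrL Lm (b n) := fun n => by
    have := (scrL_mem_Icc (c := 0) ha₁ (lt_left_const hθ hloc hside) (hb0 n)
      (by linarith [hb1 n]) (hba₁ n)).1
    linarith
  have hLp : ∀ n, 0 ≤ scrL Lp (b n) := fun n => by
    have := (scrL_mem_Icc (c := 0) ha₂ (lt_right_const hθ hloc hside) (hb0 n)
      (by linarith [hb1 n]) (hba₂ n)).1
    linarith
  have hl : ∀ n, ∀ x ∈ Iio K, |x - K| < θ →
      G f (b n) x ∈ Ioi K ∧ |G f (b n) x - K| ≤ scrL Lm (b n) * |x - K| :=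
    fun n x hx hxθ => G_left hloc hside (hb1 n) (hba₁ n) hx hxθ
  have hr : ∀ n, ∀ x ∈ Ioi K, |x - K| < θ →
      G f (b n) x ∈ Iio K ∧ |G f (b n) x - K| ≤ scrL Lp (b n) * |x - K| :=
    fun n x hx hxθ => G_right hloc hside (hb1 n) (hba₂ n) hx hxθ
  have hsqueeze : ∀ P : ℕ → ℝ, Tendsto P atTop (𝓝 0) →
      (∀ n, |y n - K| ≤ P n * |y 0 - K|) → Tendsto y atTop (𝓝 K) := by
    intro P hP hle
    refine tendsto_iff_dist_tendsto_zero.2 (squeeze_zero (fun n => dist_nonneg) hle ?_)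
    simpa using hP.mul_const |y 0 - K|
  rcases lt_trichotomy (y 0) K with h | h | h
  · exact hsqueeze _ hlm fun n =>
      (abs_sub_le_altProd hl hr hLm hLp hy h hCm hy0 n).2
  · have hconst : ∀ n, y n = K := by
      intro n
      induction n with
      | zero => exact h
      | succ n ih => rw [hy n, ih]; unfold G; rw [hfK]; ring
    simpa only [funext hconst] using tendsto_const_nhds
  · exact hsqueeze _ hlp fun n =>
      (abs_sub_le_altProd hr hl hLp hLm hy h hCp hy0 n).2

/-! ### The noise -/

theorem measurable_sequence_iSup {Ω : Type*} (ξ : ℕ → Ω → ℝ) {m k : ℕ} (h : m ≤ k) :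
    Measurable[⨆ i ∈ Ici m, MeasurableSpace.comap (ξ i) inferInstance]
      fun ω n => ξ (k + n) ω := by
  rw [@measurable_pi_iff]
  intro n
  refine Measurable.mono (comap_measurable (ξ (k + n))) ?_ le_rfl
  exact le_iSup₂_of_le (k + n) (mem_Ici.2 (by omega)) le_rfl

namespace NoiseAssumption

variable {Ω : Type*} [MeasurableSpace Ω] {μ : Measure Ω} {ξ : ℕ → Ω → ℝ}

theorem ae_tendsto_average (hξ : NoiseAssumption μ ξ) {φ : ℝ → ℝ} (hφ : Measurable φ)
    (hint : Integrable (fun ω => φ (ξ 0 ω)) μ) {τ : ℕ → ℕ} (hτ : Function.Injective τ) :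
    ∀ᵐ ω ∂μ, Tendsto (fun n : ℕ => (∑ i ∈ Finset.range n, φ (ξ (τ i) ω)) / n) atTop
      (𝓝 (∫ ω, φ (ξ 0 ω) ∂μ)) := by
  have hid : ∀ i, IdentDistrib (fun ω => φ (ξ i ω)) (fun ω => φ (ξ 0 ω)) μ μ :=
    fun i => (hξ.identDistrib i).comp hφ
  have h := strong_law_ae_real (μ := μ) (fun i ω => φ (ξ (τ i) ω))
    ((hid (τ 0)).integrable_iff.2 hint)
    (fun i j hij => (hξ.indep.indepFun (hτ.ne hij)).comp hφ hφ)
    (fun i => (hid (τ i)).trans (hid (τ 0)).symm)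
  rwa [(hid (τ 0)).integral_eq] at h

/-- Alternating sums of functions with negative total mean tend to `-∞`. -/
theorem ae_tendsto_altSum (hξ : NoiseAssumption μ ξ) {φ ψ : ℝ → ℝ} (hφ : Measurable φ)
    (hψ : Measurable ψ) (hφi : Integrable (fun ω => φ (ξ 0 ω)) μ)
    (hψi : Integrable (fun ω => ψ (ξ 0 ω)) μ)
    (hneg : ∫ ω, φ (ξ 0 ω) ∂μ + ∫ ω, ψ (ξ 0 ω) ∂μ < 0) {M : ℝ}
    (hM : ∀ z, |z| ≤ 1 → φ z ≤ M) :
    ∀ᵐ ω ∂μ, Tendsto (fun n => ∑ j ∈ Finset.range n, if Even j then φ (ξ j ω) else ψ (ξ j ω))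
      atTop atBot := by
  filter_upwards [hξ.ae_tendsto_average hφ hφi (τ := fun i => 2 * i) fun i j h => by grind,
    hξ.ae_tendsto_average hψ hψi (τ := fun i => 2 * i + 1) fun i j h => by grind,
    ae_all_iff.2 hξ.bounded] with ω h1 h2 hbd
  set S : ℕ → ℝ := fun n => ∑ j ∈ Finset.range n, if Even j then φ (ξ j ω) else ψ (ξ j ω)
  have hS : ∀ n, S (2 * n) = ∑ i ∈ Finset.range n, φ (ξ (2 * i) ω) +
      ∑ i ∈ Finset.range n, ψ (ξ (2 * i + 1) ω) := by
    intro n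
    induction n with
    | zero => simp [S]
    | succ n ih =>
      have e : S (2 * (n + 1)) = S (2 * n) + φ (ξ (2 * n) ω) + ψ (ξ (2 * n + 1) ω) := by
        simp only [S, show 2 * (n + 1) = 2 * n + 1 + 1 by ring, Finset.sum_range_succ]
        rw [if_pos (even_two_mul n), if_neg (by simp)]
      rw [e, ih, Finset.sum_range_succ, Finset.sum_range_succ]
      ring
  -- The even and odd averages add up to a sequence with negative limit, which is then multiplied by
  -- `n`.
  have hev : Tendsto (fun n => S (2 * n)) atTop atBot := by
    have h3 := (h1.add h2).neg_mul_atTop hneg tendsto_natCast_atTop_atTop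
    refine h3.congr' ?_
    filter_upwards [eventually_gt_atTop 0] with n hn
    have : (n : ℝ) ≠ 0 := by positivity
    rw [hS n]
    field_simp
  -- An odd partial sum exceeds the preceding even one by a single term, at most `M`.
  have hle : ∀ n, S n ≤ S (2 * (n / 2)) + |M| := by
    intro n
    rcases Nat.even_or_odd' n with ⟨k, rfl | rfl⟩
    · rw [Nat.mul_div_cancel_left k two_pos]
      linarith [abs_nonneg M]
    · rw [show (2 * k + 1) / 2 = k by omega]
      have e : S (2 * k + 1) = S (2 * k) + φ (ξ (2 * k) ω) := by
        simp only [S, Finset.sum_range_succ]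
        rw [if_pos (even_two_mul k)]
      linarith [hM _ (hbd (2 * k)), le_abs_self M]
  refine tendsto_atBot_mono hle (tendsto_atBot_add_const_right _ _ ?_)
  exact hev.comp (Nat.tendsto_div_const_atTop two_ne_zero)

/-- The product is the exponential of an alternating sum of logarithms; the bounds away from `0`
make these logarithms integrable. -/
theorem ae_tendsto_altProd (hξ : NoiseAssumption μ ξ) [IsProbabilityMeasure μ]
    {L₀ L₁ α ℓ c₀ c₁ : ℝ} (hc₀ : 0 < c₀) (hc₁ : 0 < c₁)
    (h₀ : ∀ z, |z| ≤ 1 → scrL L₀ (α + ℓ * z) ∈ Icc c₀ L₀)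
    (h₁ : ∀ z, |z| ≤ 1 → scrL L₁ (α + ℓ * z) ∈ Icc c₁ L₁)
    (hlog : ∫ ω, Real.log |scrL L₀ (α + ℓ * ξ 0 ω) * scrL L₁ (α + ℓ * ξ 0 ω)| ∂μ < 0) :
    ∀ᵐ ω ∂μ, Tendsto (altProd L₀ L₁ fun j => α + ℓ * ξ j ω) atTop (𝓝 0) := by
  have hmeas : ∀ L : ℝ, Measurable fun z => Real.log (scrL L (α + ℓ * z)) := by
    intro L
    unfold scrL
    fun_prop
  have hint : ∀ L c : ℝ, 0 < c → (∀ z, |z| ≤ 1 → scrL L (α + ℓ * z) ∈ Icc c L) →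
      Integrable (fun ω => Real.log (scrL L (α + ℓ * ξ 0 ω))) μ := by
    intro L c hc h
    refine Integrable.of_mem_Icc (Real.log c) (Real.log L)
      ((hmeas L).comp (hξ.measurable 0)).aemeasurable ?_
    filter_upwards [hξ.bounded 0] with ω hω
    have := h _ hω
    exact ⟨Real.log_le_log hc this.1, Real.log_le_log (hc.trans_le this.1) this.2⟩
  have hsum : ∫ ω, Real.log (scrL L₀ (α + ℓ * ξ 0 ω)) ∂μ +
      ∫ ω, Real.log (scrL L₁ (α + ℓ * ξ 0 ω)) ∂μ < 0 := by
    rw [← integral_add (hint L₀ c₀ hc₀ h₀) (hint L₁ c₁ hc₁ h₁)]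
    refine lt_of_eq_of_lt (integral_congr_ae ?_) hlog
    filter_upwards [hξ.bounded 0] with ω hω
    rw [Real.log_abs, Real.log_mul (hc₀.trans_le (h₀ _ hω).1).ne' (hc₁.trans_le (h₁ _ hω).1).ne']
  filter_upwards [hξ.ae_tendsto_altSum (hmeas L₀) (hmeas L₁) (hint L₀ c₀ hc₀ h₀)
    (hint L₁ c₁ hc₁ h₁) hsum (M := Real.log L₀)
    (fun z hz => Real.log_le_log (hc₀.trans_le (h₀ z hz).1) (h₀ z hz).2),
    ae_all_iff.2 hξ.bounded] with ω hω hbd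
  refine (Real.tendsto_exp_atBot.comp hω).congr fun n => ?_
  simp only [Function.comp, Real.exp_sum, altProd]
  refine Finset.prod_congr rfl fun j _ => ?_
  split_ifs
  · exact Real.exp_log (hc₀.trans_le (h₀ _ (hbd j)).1)
  · exact Real.exp_log (hc₁.trans_le (h₁ _ (hbd j)).1)

theorem measurable_sequence (hξ : NoiseAssumption μ ξ) (k : ℕ) :
    Measurable fun ω n => ξ (k + n) ω :=
  measurable_pi_iff.2 fun n => hξ.measurable (k + n)

/-- The noise sequence is stationary. -/
theorem map_sequence (hξ : NoiseAssumption μ ξ) (k : ℕ) :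
    μ.map (fun ω n => ξ (k + n) ω) = μ.map (fun ω n => ξ n ω) := by
  rw [iIndepFun.map_fun_eq_infinitePi_map (X := fun n => ξ (k + n))
      (fun n => hξ.measurable (k + n)) (hξ.indep.precomp (add_right_injective k)),
    iIndepFun.map_fun_eq_infinitePi_map hξ.measurable hξ.indep]
  congr 1
  funext n
  exact (hξ.identDistrib (k + n)).map_eq.trans (hξ.identDistrib n).map_eq.symm

theorem measure_shift_mem (hξ : NoiseAssumption μ ξ) (k : ℕ) {E : Set (ℕ → ℝ)}
    (hE : MeasurableSet E) :
    μ {ω | (fun n => ξ (k + n) ω) ∈ E} = μ {ω | (fun n => ξ n ω) ∈ E} := by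
  have h := congrArg (fun ν => ν E) (hξ.map_sequence k)
  rwa [Measure.map_apply (hξ.measurable_sequence k) hE,
    Measure.map_apply (measurable_pi_iff.2 hξ.measurable) hE] at h

/-- An event of positive probability for the noise sequence occurs infinitely often along its
shifts, almost surely. -/
theorem ae_frequently_shift_mem (hξ : NoiseAssumption μ ξ) [IsProbabilityMeasure μ]
    {E : Set (ℕ → ℝ)} (hE : MeasurableSet E) (hpos : 0 < μ {ω | (fun n => ξ n ω) ∈ E}) :
    ∀ᵐ ω ∂μ, ∃ᶠ k in atTop, (fun n => ξ (k + n) ω) ∈ E := by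
  set A : ℕ → Set Ω := fun k => {ω | (fun n => ξ (k + n) ω) ∈ E} with hA
  set T : Set Ω := ⋂ m, ⋃ k ∈ Ici m, A k with hT
  have hAm : ∀ k, MeasurableSet (A k) := fun k => hξ.measurable_sequence k hE
  have hanti : Antitone fun m => ⋃ k ∈ Ici m, A k := fun m n hmn =>
    biUnion_subset_biUnion_left (Ici_subset_Ici.2 hmn)
  have hUm : ∀ m, MeasurableSet (⋃ k ∈ Ici m, A k) := fun m =>
    MeasurableSet.biUnion (to_countable _) fun k _ => hAm k
  -- By stationarity each union in `T` has at least the measure of the original event, and this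
  -- passes to the decreasing limit.
  have hTpos : μ T ≠ 0 := by
    have h1 := tendsto_measure_iInter_atTop (μ := μ)
      (fun m => (hUm m).nullMeasurableSet) hanti ⟨0, measure_ne_top _ _⟩
    have h2 : μ {ω | (fun n => ξ n ω) ∈ E} ≤ μ T := by
      refine ge_of_tendsto' h1 fun m => ?_
      rw [← hξ.measure_shift_mem m hE]
      exact measure_mono (subset_biUnion_of_mem (u := A) (mem_Ici.2 le_rfl))
    exact (hpos.trans_le h2).ne'
  have hTtail : MeasurableSet[limsup (fun i => MeasurableSpace.comap (ξ i) inferInstance) atTop]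
      T := by
    rw [limsup_eq_iInf_iSup_of_nat, MeasurableSpace.measurableSet_iInf]
    intro m
    -- The unions decrease, so dropping the first `m` of them leaves `T` unchanged and shows that it
    -- depends only on noises from `m` on.
    have hTm : T = ⋂ n, ⋃ k ∈ Ici (n + m), A k := by
      refine subset_antisymm (fun ω hω => mem_iInter.2 fun n => mem_iInter.1 hω (n + m))
        (fun ω hω => mem_iInter.2 fun n => ?_)
      exact hanti (Nat.le_add_right n m) (mem_iInter.1 hω n)
    rw [hTm]
    refine MeasurableSet.iInter fun n => MeasurableSet.biUnion (to_countable _) fun k hk => ?_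
    exact measurable_sequence_iSup ξ (show m ≤ k from (Nat.le_add_left m n).trans hk) hE
  have hone : μ T = 1 :=
    (measure_zero_or_one_of_measurableSet_limsup_atTop
      (fun n => (hξ.measurable n).comap_le) hξ.indep hTtail).resolve_left hTpos
  filter_upwards [mem_ae_iff_prob_eq_one (MeasurableSet.iInter hUm) |>.2 hone] with ω hω
  refine frequently_atTop.2 fun m => ?_
  obtain ⟨k, hk, hkA⟩ := mem_iUnion₂.1 (mem_iInter.1 hω m)
  exact ⟨k, hk, hkA⟩

/-- A prescribed finite beginning near `1` followed by a likely event has positive probability. -/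
theorem measure_inter_shift_pos (hξ : NoiseAssumption μ ξ) [IsProbabilityMeasure μ] (N : ℕ) {ε : ℝ}
    (hε : 0 < ε) {D : Set (ℕ → ℝ)} (hD : MeasurableSet D)
    (hpos : 0 < μ {ω | (fun n => ξ n ω) ∈ D}) :
    0 < μ {ω | (∀ n < N, ξ n ω ∈ Ioc (1 - ε) 1) ∧ (fun n => ξ (N + n) ω) ∈ D} := by
  have hind := indep_iSup_of_disjoint (fun n => (hξ.measurable n).comap_le) hξ.indep
    (S := Iio N) (T := Ici N) (by
      rw [Set.disjoint_left]
      exact fun i hi hi' => absurd (mem_Ici.1 hi') (not_le.2 (mem_Iio.1 hi)))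
  set B : Set Ω := ⋂ n ∈ Finset.range N, ξ n ⁻¹' Ioc (1 - ε) 1 with hB
  have hBm : MeasurableSet[⨆ i ∈ Iio N, MeasurableSpace.comap (ξ i) inferInstance] B := by
    refine MeasurableSet.biInter (to_countable _) fun n hn => ?_
    have hle : MeasurableSpace.comap (ξ n) inferInstance ≤
        ⨆ i ∈ Iio N, MeasurableSpace.comap (ξ i) inferInstance :=
      le_iSup₂_of_le n (by simpa using hn) le_rfl
    exact hle _ ⟨_, measurableSet_Ioc, rfl⟩
  have hDm := measurable_sequence_iSup ξ (le_refl N) hD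
  have hmul := (Indep_iff _ _ μ).1 hind B _ hBm hDm
  have hBpos : μ B ≠ 0 := by
    rw [hB, hξ.indep.measure_inter_preimage_eq_mul (sets := fun _ => Ioc (1 - ε) 1)
      (Finset.range N) fun n _ => measurableSet_Ioc]
    refine Finset.prod_ne_zero_iff.2 fun n _ => ?_
    rw [(hξ.identDistrib n).measure_mem_eq measurableSet_Ioc]
    exact (hξ.charges_one ε hε).ne'
  have hset : {ω | (∀ n < N, ξ n ω ∈ Ioc (1 - ε) 1) ∧ (fun n => ξ (N + n) ω) ∈ D} =
      B ∩ (fun ω n => ξ (N + n) ω) ⁻¹' D := by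
    ext ω
    simp [hB]
  rw [hset, hmul]
  refine pos_iff_ne_zero.2 (mul_ne_zero hBpos ?_)
  exact (hξ.measure_shift_mem N hD).trans_ne hpos.ne'

end NoiseAssumption

/-! ### The contracting noise event -/

/-- Noise sequences for which the products of rates vanish and are bounded by `C`. -/
def contractingSet (Lm Lp α ℓ C : ℝ) : Set (ℕ → ℝ) :=
  {z | ((∀ n, altProd Lm Lp (fun j => α + ℓ * z j) n ≤ C) ∧
      ∀ n, altProd Lp Lm (fun j => α + ℓ * z j) n ≤ C) ∧
    Tendsto (altProd Lm Lp fun j => α + ℓ * z j) atTop (𝓝 0) ∧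
    Tendsto (altProd Lp Lm fun j => α + ℓ * z j) atTop (𝓝 0)}

theorem measurable_altProd (L₀ L₁ α ℓ : ℝ) (n : ℕ) :
    Measurable fun z : ℕ → ℝ => altProd L₀ L₁ (fun j => α + ℓ * z j) n := by
  unfold altProd scrL
  fun_prop

theorem measurableSet_contractingSet (Lm Lp α ℓ C : ℝ) :
    MeasurableSet (contractingSet Lm Lp α ℓ C) := by
  have hbd : ∀ L₀ L₁ : ℝ,
      MeasurableSet {z : ℕ → ℝ | ∀ n, altProd L₀ L₁ (fun j => α + ℓ * z j) n ≤ C} := by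
    intro L₀ L₁
    rw [ofPred_forall]
    exact MeasurableSet.iInter fun n => measurableSet_le (measurable_altProd _ _ _ _ n)
      measurable_const
  have hlim : ∀ L₀ L₁ : ℝ, MeasurableSet
      {z : ℕ → ℝ | Tendsto (altProd L₀ L₁ fun j => α + ℓ * z j) atTop (𝓝 0)} :=
    fun L₀ L₁ => measurableSet_tendsto (𝓝 0) fun n => measurable_altProd L₀ L₁ α ℓ n
  exact ((hbd Lm Lp).inter (hbd Lp Lm)).inter ((hlim Lm Lp).inter (hlim Lp Lm))

/-- Convergent products are bounded, so the countably many events with `C = N + 1` cover almost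
every `ω` and cannot all be null. -/
theorem NoiseAssumption.exists_contractingSet_pos {Ω : Type*} [MeasurableSpace Ω]
    {μ : Measure Ω} [IsProbabilityMeasure μ] {ξ : ℕ → Ω → ℝ} {Lm Lp α ℓ : ℝ}
    (hlm : ∀ᵐ ω ∂μ, Tendsto (altProd Lm Lp fun j => α + ℓ * ξ j ω) atTop (𝓝 0))
    (hlp : ∀ᵐ ω ∂μ, Tendsto (altProd Lp Lm fun j => α + ℓ * ξ j ω) atTop (𝓝 0)) :
    ∃ C : ℝ, 0 < C ∧ 0 < μ {ω | (fun n => ξ n ω) ∈ contractingSet Lm Lp α ℓ C} := by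
  by_contra! hcon
  have hnull : μ (⋃ N : ℕ, {ω | (fun n => ξ n ω) ∈ contractingSet Lm Lp α ℓ (N + 1)}) = 0 :=
    measure_iUnion_null fun N => le_antisymm (hcon _ (by positivity)) zero_le
  have hfull : ∀ᵐ ω ∂μ, ω ∈ ⋃ N : ℕ,
      {ω | (fun n => ξ n ω) ∈ contractingSet Lm Lp α ℓ (N + 1)} := by
    filter_upwards [hlm, hlp] with ω h1 h2
    obtain ⟨C₁, hC₁⟩ := h1.bddAbove_range
    obtain ⟨C₂, hC₂⟩ := h2.bddAbove_range
    obtain ⟨N, hN⟩ := exists_nat_ge (max C₁ C₂)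
    have hN₁ : C₁ ≤ N + 1 := by linarith [le_max_left C₁ C₂]
    have hN₂ : C₂ ≤ N + 1 := by linarith [le_max_right C₁ C₂]
    exact mem_iUnion.2 ⟨N, ⟨fun n => (hC₁ (mem_range_self n)).trans hN₁,
      fun n => (hC₂ (mem_range_self n)).trans hN₂⟩, h1, h2⟩
  have h0 : ∀ᵐ ω ∂μ, False := by
    filter_upwards [hfull, measure_eq_zero_iff_ae_notMem.1 hnull] with ω h1 h2 using h2 h1
  exact h0.exists.elim fun _ h => h

end PBC

/-! ### Almost sure convergence to `K` -/

theorem mainTheorem1 {Ω : Type*} [MeasurableSpace Ω] (μ : Measure Ω) [IsProbabilityMeasure μ]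
    (ξ : ℕ → Ω → ℝ) (hξ : PBC.NoiseAssumption μ ξ)
    (f : ℝ → ℝ) (K : ℝ) (hf : PBC.MapAssumption f K)
    (θ Lm Lp a₁ a₂ : ℝ) (hθ : 0 < θ) (hθK : θ < K)
    (hloc : PBC.LocalLipschitz f K θ Lm Lp)
    (ha₁ : 0 < a₁) (ha₂ : 0 < a₂) (hside : PBC.SideSwitching f K θ a₁ a₂)
    (α ℓ : ℝ)
    (hlog : ∫ ω, Real.log |PBC.scrL Lm (α + ℓ * ξ 0 ω) * PBC.scrL Lp (α + ℓ * ξ 0 ω)| ∂μ < 0)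
    (hsum : α + ℓ ≤ min (a₁ / (a₁ + 1)) (a₂ / (a₂ + 1)))
    (hα : α ∈ Set.Ioo 0 (PBC.betaStar f K))
    (hℓ : ℓ ∈ Set.Ioo (PBC.betaStar f K - α) (min α (1 - α)))
    (x₀ : ℝ) (hx₀ : 0 < x₀) (x : ℕ → Ω → ℝ) (hx : PBC.IsSolution f α ℓ ξ x₀ x) :
    ∀ᵐ ω ∂μ, Filter.Tendsto (fun n => x n ω) Filter.atTop (nhds K) := by
  open PBC in
  have hℓ0 : 0 < ℓ := by linarith [hα.2, hℓ.1]
  have hℓα : ℓ < α := hℓ.2.trans_le (min_le_left _ _)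
  have hαℓ : α + ℓ < 1 := by linarith [hℓ.2.trans_le (min_le_right α (1 - α))]
  have hK := hf.K_lt_fMax hθ hθK ha₁ hside
  have hmK := hf.fMin_lt_K hθ ha₂ hside hK
  have hfc : ContinuousOn f (Icc (fMin f K) (fMax f K)) :=
    hf.continuousOn.mono fun z hz => hf.fMin_nonneg.trans hz.1
  -- the control range
  have hrange : ∀ z : ℝ, |z| ≤ 1 → 0 < α + ℓ * z ∧ 1 - α - ℓ ≤ 1 - (α + ℓ * z) := by
    intro z hz
    have h1 := abs_le.1 hz
    have h2 := mul_le_mul_of_nonneg_left h1.1 hℓ0.le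
    have h3 := mul_le_mul_of_nonneg_left h1.2 hℓ0.le
    constructor <;> linarith
  have hr₁ : ∀ z : ℝ, |z| ≤ 1 → α + ℓ * z ≤ (1 - (α + ℓ * z)) * a₁ := fun z hz =>
    le_one_sub_mul_of_le_div ha₁
      (by linarith [(hrange z hz).2, hsum.trans (min_le_left _ _)])
  have hr₂ : ∀ z : ℝ, |z| ≤ 1 → α + ℓ * z ≤ (1 - (α + ℓ * z)) * a₂ := fun z hz =>
    le_one_sub_mul_of_le_div ha₂
      (by linarith [(hrange z hz).2, hsum.trans (min_le_right _ _)])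
  -- the local contraction
  have hLm : ∀ z : ℝ, |z| ≤ 1 →
      scrL Lm (α + ℓ * z) ∈ Icc ((1 - α - ℓ) * (Lm - a₁)) Lm := fun z hz =>
    scrL_mem_Icc ha₁ (lt_left_const hθ hloc hside) (hrange z hz).1.le (hrange z hz).2 (hr₁ z hz)
  have hLp : ∀ z : ℝ, |z| ≤ 1 →
      scrL Lp (α + ℓ * z) ∈ Icc ((1 - α - ℓ) * (Lp - a₂)) Lp := fun z hz =>
    scrL_mem_Icc ha₂ (lt_right_const hθ hloc hside) (hrange z hz).1.le (hrange z hz).2 (hr₂ z hz)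
  have hcm : 0 < (1 - α - ℓ) * (Lm - a₁) :=
    mul_pos (by linarith) (by linarith [lt_left_const hθ hloc hside])
  have hcp : 0 < (1 - α - ℓ) * (Lp - a₂) :=
    mul_pos (by linarith) (by linarith [lt_right_const hθ hloc hside])
  obtain ⟨C, hC, hCpos⟩ := NoiseAssumption.exists_contractingSet_pos
    (hξ.ae_tendsto_altProd hcm hcp hLm hLp hlog)
    (hξ.ae_tendsto_altProd hcp hcm hLp hLm (by simpa only [mul_comm] using hlog))
  -- the strongest control drives the interval close to `K`
  obtain ⟨β₀, hβ₀, hβ₀lt⟩ : ∃ β₀ ∈ stabilizing f K, β₀ < α + ℓ := by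
    refine exists_lt_of_csInf_lt ?_ (show betaStar f K < α + ℓ by linarith [hℓ.1])
    -- If no control were stabilizing, `betaStar` would take the default value `sInf ∅ = 0`, against
    -- `0 < α < betaStar f K`.
    by_contra hemp
    have h0 := hα.1.trans hα.2
    rw [betaStar, not_nonempty_iff_eq_empty.1 hemp, Real.sInf_empty] at h0
    exact lt_irrefl _ h0
  have hstab := hf.stabilizing_of_le hβ₀ hβ₀lt.le hαℓ
  have hmaps : ∀ z ∈ Icc (fMin f K) (fMax f K), G f (α + ℓ) z ∈ Ioo (fMin f K) (fMax f K) :=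
    fun z hz => hf.G_mem_Ioo hstab.1 hK hmK hz
  -- Two errors of this size, from the iterates and from the noisy controls, add up to `θ / C`.
  have hδ : 0 < θ / (2 * C) := by positivity
  obtain ⟨N, hN⟩ := exists_iterate_near (continuousOn_G hfc (α + ℓ)) ⟨hmK, hK⟩ hmaps
    (hf.G_K _) (fun z hz => hf.lt_G hαℓ ⟨hf.fMin_nonneg.trans_lt hz.1, hz.2⟩)
    (fun z hz => hf.G_lt hαℓ hz.1) hstab.2.1 hδ
  obtain ⟨ε, hε, hnear⟩ := exists_trajectory_near_iterate hfc
    (fun z hz => Ioo_subset_Icc_self (hmaps z hz)) N hδ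
  -- the favourable event occurs infinitely often
  have hDm := measurableSet_contractingSet Lm Lp α ℓ C
  -- A noise in `(1 - ε / ℓ, 1]` puts the control within `ε` of `α + ℓ`.
  set E : Set (ℕ → ℝ) := {z | (∀ n < N, z n ∈ Ioc (1 - ε / ℓ) 1) ∧
    (fun n => z (N + n)) ∈ contractingSet Lm Lp α ℓ C} with hE
  have hEm : MeasurableSet E := by
    have hshift : Measurable fun (z : ℕ → ℝ) n => z (N + n) := by fun_prop
    have hinit : MeasurableSet {z : ℕ → ℝ | ∀ n < N, z n ∈ Ioc (1 - ε / ℓ) 1} := by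
      simp only [ofPred_forall]
      exact MeasurableSet.iInter fun n => MeasurableSet.iInter fun _ =>
        measurable_pi_apply n measurableSet_Ioc
    exact hinit.inter (hshift hDm)
  filter_upwards [hξ.ae_frequently_shift_mem hEm
    (hξ.measure_inter_shift_pos N (div_pos hε hℓ0) hDm hCpos),
    ae_all_iff.2 hξ.bounded] with ω hω hbd
  have hstep : ∀ n, x (n + 1) ω = G f (α + ℓ * ξ n ω) (x n ω) := fun n => by
    rw [hx.2 n ω, G]; ring
  obtain ⟨n₀, hn₀⟩ := hf.eventually_mem_Icc (b := fun n => α + ℓ * ξ n ω)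
    (y := fun n => x n ω) (show 0 < 1 - α - ℓ by linarith) (fun n => (hrange _ (hbd n)).2)
    (fun n => (hrange _ (hbd n)).1) hstep (by rw [hx.1]; exact hx₀) hK hmK
  -- The entry time `n₀` depends on `ω`, which is why the event must recur arbitrarily late.
  obtain ⟨k, hk, hkE⟩ := frequently_atTop.1 hω n₀
  have h1 := hnear (fun n => α + ℓ * ξ (k + n) ω) (fun n => x (k + n) ω)
    (fun n => hstep (k + n)) (fun n => hn₀ _ (hk.trans (Nat.le_add_right _ _)))
    (fun n hn => by
      have h := hkE.1 n hn
      have h2 : ℓ * (1 - ε / ℓ) ≤ ℓ * ξ (k + n) ω := mul_le_mul_of_nonneg_left h.1.le hℓ0.le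
      have h3 : ℓ * ξ (k + n) ω ≤ ℓ * 1 := mul_le_mul_of_nonneg_left h.2 hℓ0.le
      have h4 : ℓ * (1 - ε / ℓ) = ℓ - ε := by field_simp
      rw [abs_le]
      constructor <;> linarith)
  have h2 := hN _ (hn₀ (k + 0) hk)
  have hclose : C * |x (k + N) ω - K| < θ := by
    have h3 : |x (k + N) ω - K| < θ / C := by
      calc _ ≤ _ := abs_sub_le _ ((G f (α + ℓ))^[N] (x (k + 0) ω)) _
        _ < θ / (2 * C) + θ / (2 * C) := add_lt_add h1 h2
        _ = θ / C := by field_simp; norm_num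
    rwa [lt_div_iff₀ hC, mul_comm] at h3
  obtain ⟨⟨hCm, hCp⟩, hlm, hlp⟩ := hkE.2
  have hlim : Tendsto (fun n => x (k + N + n) ω) atTop (𝓝 K) :=
    tendsto_of_altProd (b := fun n => α + ℓ * ξ (k + (N + n)) ω) hf.map_K hθ ha₁ ha₂ hloc hside
      (fun n => (hrange _ (hbd _)).1.le) (fun n => by linarith [(hrange _ (hbd (k + (N + n)))).2])
      (fun n => hr₁ _ (hbd _)) (fun n => hr₂ _ (hbd _))
      (fun n => by rw [← add_assoc k N n]; exact hstep (k + N + n)) hCm hCp hlm hlp hclose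
  refine (tendsto_add_atTop_iff_nat (k + N)).1 (hlim.congr fun n => ?_)
  rw [add_comm]
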